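/- **Setting.** For $\alpha\ge 1$ let $\|X\|_{\psi_\alpha}=\inf\{c>0:\mathbb E[\exp((|X|/c)^\alpha)-1]\le 1\}$. Let $Z$ be a centered, symmetric real random variable with unit variance and $\|Z\|_{\psi_2}\le K_1$. Let $n\ge 2$ and let $\mathbf a_1,\dots,\mathbf a_m$ be independent copies of a random vector $\mathbf a\in\mathbb R^n$ whose coordinates are independent copies of $Z$. Let $f$ be a (possibly random) measurable link function, let $\mathbf x_*\in\mathbb R^n$ be a unit norm vector, and let $y_i=f_i(\langle \mathbf a_i,\mathbf x_*\rangle)$, where $f_1,\dots,f_m$ are independent copies of $f$, independent of the $\mathbf a_i$ (so $f_i=f$ when $f$ is deterministic). Put $$\hat{\boldsymbol\Sigma}=\frac1m\sum_{i=1}^m y_i(\mathbf a_i\mathbf a_i^T-\mathbf I_n),\qquad \boldsymbol\Sigma=\mathbb E\,\hat{\boldsymbol\Sigma}.$$ For an integer $k\ge1$ let $Z_1,\dots,Z_k$ be independent copies of $Z$ (independent of $f$), $\bar Z_k=\frac1k\sum_{i\le k}Z_i$ and $\mathbf r_{k,Z}=(Z_1-\bar Z_k,\dots,Z_k-\bar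 Z_k)$. The correlation condition $(A_{f,Z,k})$ is $$\mathrm{Cov}\big((\sqrt k\bar Z_k)^2,f(\sqrt k\bar Z_k)\big)>0,\quad \mathrm{Cov}\big(\|\mathbf r_{k,Z}\|_2^2,f(\sqrt k\bar Z_k)\big)\le0,\quad \|f(\sqrt k\bar Z_k)\|_{\psi_1}\le K_2 .$$ A vector $\mathbf x_*$ is *admissible* (for the sparsity parameter $s$) if there is $I\subset[n]$ with $|I|\le s$ such that $(\mathbf x_*)_j=\pm 1/\sqrt{|I|}$ for $j\in I$ and $(\mathbf x_*)_j=0$ for $j\notin I$. **Proposition.** For all $K_1,K_2$ there is a constant $C>0$, depending only on $K_1$ and $K_2$, such that the following holds for all $m$, $n\ge2$ and $1\le k\le s$. Suppose that $(A_{f,Z,k})$ holds, and, if $Z$ is not standard Gaussian, suppose further that $\mathbf x_*$ is admissible with exactly $k$ nonzero entries. (If $Z$ is standard Gaussian, $\mathbf x_*$ may be any unit norm vector.) Then the entries of $\hat{\boldsymbol\Sigma}$ are integrable, and for every $\delta>0$ with $$m\ge C\max\{s/\delta,\ \log(n/\delta)\log^2 m\}$$ the entrywise maximum norm of the error satisfies,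 with probability at least $1-\delta$, $$\|\hat{\boldsymbol\Sigma}-\boldsymbol\Sigma\|_\infty\le \frac{C\big(\sqrt{\log(n/\delta)}+\log^2(s/\delta)\big)}{\sqrt m}.$$ (For $\delta\ge1$ the claim is empty.) -/

import Mathlib

open MeasureTheory ProbabilityTheory
open scoped ENNReal

/-- The `ψ_α` Orlicz norm (for `α ≥ 1`) of a real random variable `X`, i.e. the infimum of all
`c > 0` with `𝔼 [exp ((|X| / c) ^ α) - 1] ≤ 1`. It takes the value `∞` if there is no such `c`. -/
noncomputable def psiNorm {Ω : Type*} [MeasurableSpace Ω] (α : ℝ) (X : Ω → ℝ) (P : Measure Ω) :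
    ℝ≥0∞ :=
  sInf {t : ℝ≥0∞ | ∃ c : ℝ, 0 < c ∧ t = ENNReal.ofReal c ∧
    ∫⁻ ω, ENNReal.ofReal (Real.exp ((|X ω| / c) ^ α) - 1) ∂P ≤ 1}

/-- The law `ν` of the random variable `Z`: centered, symmetric, of unit variance, and with
subgaussian norm at most `K`. -/
structure IsSamplingLaw (ν : Measure ℝ) (K : ℝ) : Prop where
  prob : IsProbabilityMeasure ν
  centered : ∫ z, z ∂ν = 0
  symmetric : ν.map (fun z => -z) = ν
  unit_variance : Var[fun z => z; ν] = 1
  subgaussian : psiNorm 2 (fun z => z) ν ≤ ENNReal.ofReal K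

/-- The mean of `Z₁, …, Z_k`. -/
noncomputable def sampleMean {k : ℕ} (z : Fin k → ℝ) : ℝ := (1 / (k : ℝ)) * ∑ i, z i

/-- `√k` times the mean of `Z₁, …, Z_k`. -/
noncomputable def scaledMean {k : ℕ} (z : Fin k → ℝ) : ℝ := Real.sqrt k * sampleMean z

/-- The squared Euclidean norm of the vector of residuals `(Z₁ - Z̄, …, Z_k - Z̄)`. -/
noncomputable def residualSq {k : ℕ} (z : Fin k → ℝ) : ℝ := ∑ i, (z i - sampleMean z) ^ 2

/-- The joint law of `k` independent copies of `Z ∼ ν` and of an independent noise variable with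
law `ρ`; the noise carries the randomness of the link function. -/
noncomputable def copiesLaw {Ξ : Type*} [MeasurableSpace Ξ] (ν : Measure ℝ) (ρ : Measure Ξ)
    (k : ℕ) : Measure ((Fin k → ℝ) × Ξ) :=
  (Measure.pi (fun _ : Fin k => ν)).prod ρ

/-- `μ(f, Z, k) = Cov((√k Z̄_k)², f(√k Z̄_k))` for the random function `f = f ξ`, `ξ ∼ ρ`. -/
noncomputable def muCorr {Ξ : Type*} [MeasurableSpace Ξ] (f : Ξ → ℝ → ℝ) (ν : Measure ℝ)
    (ρ : Measure Ξ) (k : ℕ) : ℝ :=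
  cov[fun p : (Fin k → ℝ) × Ξ => scaledMean p.1 ^ 2, fun p => f p.2 (scaledMean p.1);
    copiesLaw ν ρ k]

/-- `σ(f, Z, k) = Cov(‖r_{k,Z}‖₂², f(√k Z̄_k))` for the random function `f = f ξ`, `ξ ∼ ρ`. -/
noncomputable def sigmaCorr {Ξ : Type*} [MeasurableSpace Ξ] (f : Ξ → ℝ → ℝ) (ν : Measure ℝ)
    (ρ : Measure Ξ) (k : ℕ) : ℝ :=
  cov[fun p : (Fin k → ℝ) × Ξ => residualSq p.1, fun p => f p.2 (scaledMean p.1);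
    copiesLaw ν ρ k]

/-- The correlation condition for `f`, `Z ∼ ν` and `k` summands, with subexponential bound `K`. -/
structure CorrelationCondition {Ξ : Type*} [MeasurableSpace Ξ] (f : Ξ → ℝ → ℝ) (ν : Measure ℝ)
    (ρ : Measure Ξ) (k : ℕ) (K : ℝ) : Prop where
  mu_pos : 0 < muCorr f ν ρ k
  sigma_nonpos : sigmaCorr f ν ρ k ≤ 0
  subexponential : psiNorm 1 (fun p : (Fin k → ℝ) × Ξ => f p.2 (scaledMean p.1))
    (copiesLaw ν ρ k) ≤ ENNReal.ofReal K

/-- A vector is admissible for the sparsity parameter `s` if it has entries `± 1 / √|I|` on an index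
set `I` with `|I| ≤ s`, and vanishes off `I`. -/
def IsAdmissible {n : ℕ} (s : ℕ) (x : EuclideanSpace ℝ (Fin n)) : Prop :=
  ∃ I : Finset (Fin n), I.card ≤ s ∧
    (∀ j ∈ I, x j = 1 / Real.sqrt I.card ∨ x j = -(1 / Real.sqrt I.card)) ∧
    ∀ j ∉ I, x j = 0

/-- `a₁, …, a_m` are independent copies of a random vector in `ℝⁿ` whose coordinates are independent
with law `ν`, and `ξ₁, …, ξ_m` are independent noise variables with law `ρ`, independent of the
`a_i`. -/
structure IsSample {Ω Ξ : Type*} [MeasurableSpace Ω] [MeasurableSpace Ξ] {m n : ℕ}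
    (P : Measure Ω) (ν : Measure ℝ) (ρ : Measure Ξ)
    (a : Fin m → Ω → EuclideanSpace ℝ (Fin n)) (ξ : Fin m → Ω → Ξ) : Prop where
  measurable_vec : ∀ i, Measurable (a i)
  measurable_noise : ∀ i, Measurable (ξ i)
  coord_law : ∀ i j, P.map (fun ω => a i ω j) = ν
  coord_indep : ∀ i, iIndepFun (fun (j : Fin n) ω => a i ω j) P
  noise_law : ∀ i, P.map (ξ i) = ρ
  noise_indep : ∀ i, IndepFun (a i) (ξ i) P
  sample_indep : iIndepFun (fun i ω => (a i ω, ξ i ω)) P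

/-- The measurement `y_i = f_i(⟨a_i, x⟩)`, where `f_i = f ξ_i`. -/
noncomputable def measurement {Ω Ξ : Type*} {m n : ℕ} (f : Ξ → ℝ → ℝ)
    (a : Fin m → Ω → EuclideanSpace ℝ (Fin n)) (ξ : Fin m → Ω → Ξ)
    (x : EuclideanSpace ℝ (Fin n)) (i : Fin m) (ω : Ω) : ℝ :=
  f (ξ i ω) (inner ℝ (a i ω) x)

/-- The reweighted sample covariance matrix `(1/m) ∑ y_i (a_i a_iᵀ - I_n)`. -/
noncomputable def sampleCov {Ω Ξ : Type*} {m n : ℕ} (f : Ξ → ℝ → ℝ)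
    (a : Fin m → Ω → EuclideanSpace ℝ (Fin n)) (ξ : Fin m → Ω → Ξ)
    (x : EuclideanSpace ℝ (Fin n)) (ω : Ω) : Matrix (Fin n) (Fin n) ℝ :=
  (1 / (m : ℝ)) • ∑ i, measurement f a ξ x i ω •
    (Matrix.vecMulVec (fun j => a i ω j) (fun j => a i ω j) - 1)

/-- The entrywise expectation of a random matrix. -/
noncomputable def matrixExpectation {Ω : Type*} [MeasurableSpace Ω] {n : ℕ}
    (A : Ω → Matrix (Fin n) (Fin n) ℝ) (P : Measure Ω) : Matrix (Fin n) (Fin n) ℝ :=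
  Matrix.of fun k l => ∫ ω, A ω k l ∂P

/-- The entrywise `ℓ_∞` norm of a matrix. -/
noncomputable def entrySupNorm {n : ℕ} (A : Matrix (Fin n) (Fin n) ℝ) : ℝ :=
  ⨆ p : Fin n × Fin n, |A p.1 p.2|

/-- A random variable with a bounded exponential moment at scale `κ`. -/
structure HasExpMoment {Ω : Type*} [MeasurableSpace Ω] (κ : ℝ) (X : Ω → ℝ) (P : Measure Ω) :
    Prop where
  integrable : Integrable (fun ω => Real.exp (|X ω| / κ)) P
  integral_le : ∫ ω, Real.exp (|X ω| / κ) ∂P ≤ 6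

theorem Real.exp_le_one_add_self_add_sq_mul_exp_abs (x : ℝ) :
    Real.exp x ≤ 1 + x + x ^ 2 * Real.exp |x| := by
  have h := Complex.norm_exp_sub_sum_le_norm_mul_exp (x : ℂ) 2
  have e : Complex.exp x - ∑ m ∈ Finset.range 2, (x : ℂ) ^ m / (m.factorial : ℂ)
      = ((Real.exp x - 1 - x : ℝ) : ℂ) := by
    simp [Finset.sum_range_succ]; ring
  rw [e, Complex.norm_real, Complex.norm_real, Real.norm_eq_abs, Real.norm_eq_abs, sq_abs] at h
  linarith [le_abs_self (Real.exp x - 1 - x)]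

theorem Real.sq_le_two_mul_exp {x : ℝ} (hx : 0 ≤ x) : x ^ 2 ≤ 2 * Real.exp x := by
  nlinarith [Real.quadratic_le_exp_of_nonneg hx]

section HasExpMoment

variable {Ω : Type*} [MeasurableSpace Ω] {P : Measure Ω} {κ : ℝ} {Y W : Ω → ℝ}

theorem HasExpMoment.integrable_of_abs_le (hY : HasExpMoment κ Y P) (hW : HasExpMoment κ W P)
    {g : Ω → ℝ} (hg : Measurable g) {c : ℝ}
    (h : ∀ ω, |g ω| ≤ c * (Real.exp (|Y ω| / κ) + Real.exp (|W ω| / κ))) : Integrable g P :=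
  ((hY.integrable.add hW.integrable).const_mul c).mono' hg.aestronglyMeasurable
    (Filter.Eventually.of_forall h)

theorem HasExpMoment.abs_integral_le (hY : HasExpMoment κ Y P) (hW : HasExpMoment κ W P)
    {g : Ω → ℝ} {c : ℝ} (hc : 0 ≤ c)
    (h : ∀ ω, |g ω| ≤ c * (Real.exp (|Y ω| / κ) + Real.exp (|W ω| / κ))) :
    |∫ ω, g ω ∂P| ≤ 12 * c := by
  have hi : Integrable (fun ω => c * (Real.exp (|Y ω| / κ) + Real.exp (|W ω| / κ))) P :=
    (hY.integrable.add hW.integrable).const_mul c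
  refine (norm_integral_le_of_norm_le (f := g) hi (Filter.Eventually.of_forall h)).trans ?_
  rw [integral_const_mul, integral_add hY.integrable hW.integrable]
  nlinarith [hY.integral_le, hW.integral_le]

theorem HasExpMoment.measureReal_ge_le [IsFiniteMeasure P] (hκ : 0 < κ)
    (hY : HasExpMoment κ Y P) (L : ℝ) :
    P.real {ω | L ≤ |Y ω|} ≤ 6 * Real.exp (-(L / κ)) := by
  have h := mul_meas_ge_le_integral_of_nonneg
    (Filter.Eventually.of_forall fun ω => (Real.exp_pos (|Y ω| / κ)).le) hY.integrable
    (Real.exp (L / κ))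
  have e : {ω | Real.exp (L / κ) ≤ Real.exp (|Y ω| / κ)} = {ω | L ≤ |Y ω|} := by
    ext ω
    simp [div_le_div_iff_of_pos_right hκ]
  rw [e] at h
  rw [Real.exp_neg, ← div_eq_mul_inv, le_div_iff₀ (Real.exp_pos _), mul_comm]
  exact h.trans hY.integral_le

theorem exp_half_mul_exp_half_le (κ y w : ℝ) :
    2 * (Real.exp (y / (2 * κ)) * Real.exp (w / (2 * κ))) ≤
      Real.exp (y / κ) + Real.exp (w / κ) := by
  have e : ∀ u : ℝ, Real.exp (u / κ) = Real.exp (u / (2 * κ)) ^ 2 := fun u => by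
    rw [← Real.exp_nat_mul]; congr 1; push_cast; field_simp
  rw [e y, e w]
  nlinarith [sq_nonneg (Real.exp (y / (2 * κ)) - Real.exp (w / (2 * κ)))]

theorem abs_mul_le_exp_add_exp (hκ : 0 < κ) (y w : ℝ) :
    |y| * |w| ≤ 2 * κ ^ 2 * (Real.exp (|y| / κ) + Real.exp (|w| / κ)) := by
  have b : ∀ u : ℝ, |u| ≤ 2 * κ * Real.exp (|u| / (2 * κ)) := fun u => by
    have := Real.add_one_le_exp (|u| / (2 * κ))
    have h2 : |u| = 2 * κ * (|u| / (2 * κ)) := by field_simp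
    nlinarith
  have h := mul_le_mul (b y) (b w) (abs_nonneg _) (by positivity)
  nlinarith [exp_half_mul_exp_half_le κ |y| |w|, sq_nonneg κ,
    mul_le_mul_of_nonneg_left (exp_half_mul_exp_half_le κ |y| |w|) (sq_nonneg κ)]

theorem sq_mul_sq_mul_exp_le (hκ : 0 < κ) (y w : ℝ) :
    y ^ 2 * w ^ 2 * Real.exp (|w| / (4 * κ)) ≤
      128 * κ ^ 4 * (Real.exp (|y| / κ) + Real.exp (|w| / κ)) := by
  have hy : y ^ 2 ≤ 8 * κ ^ 2 * Real.exp (|y| / (2 * κ)) := by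
    have := Real.sq_le_two_mul_exp (x := |y| / (2 * κ)) (by positivity)
    rw [div_pow, sq_abs, div_le_iff₀ (by positivity)] at this
    linarith
  have hw : w ^ 2 ≤ 32 * κ ^ 2 * Real.exp (|w| / (4 * κ)) := by
    have := Real.sq_le_two_mul_exp (x := |w| / (4 * κ)) (by positivity)
    rw [div_pow, sq_abs, div_le_iff₀ (by positivity)] at this
    linarith
  have hw' : w ^ 2 * Real.exp (|w| / (4 * κ)) ≤ 32 * κ ^ 2 * Real.exp (|w| / (2 * κ)) := by
    have e : Real.exp (|w| / (2 * κ)) = Real.exp (|w| / (4 * κ)) * Real.exp (|w| / (4 * κ)) := by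
      rw [← Real.exp_add]; ring_nf
    rw [e]
    nlinarith [Real.exp_pos (|w| / (4 * κ)), mul_le_mul_of_nonneg_right hw
      (Real.exp_pos (|w| / (4 * κ))).le]
  have h := mul_le_mul hy hw' (by positivity) (by positivity)
  have h2 := mul_le_mul_of_nonneg_left (exp_half_mul_exp_half_le κ |y| |w|)
    (show 0 ≤ 128 * κ ^ 4 by positivity)
  calc _ = y ^ 2 * (w ^ 2 * Real.exp (|w| / (4 * κ))) := by ring
    _ ≤ _ := h
    _ = 128 * κ ^ 4 * (2 * (Real.exp (|y| / (2 * κ)) * Real.exp (|w| / (2 * κ)))) := by ring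
    _ ≤ _ := h2

theorem HasExpMoment.integrable_mul (hκ : 0 < κ) (hY : HasExpMoment κ Y P)
    (hW : HasExpMoment κ W P) (hYm : Measurable Y) (hWm : Measurable W) :
    Integrable (fun ω => Y ω * W ω) P :=
  hY.integrable_of_abs_le hW (hYm.mul hWm) fun ω => by
    rw [abs_mul]; exact abs_mul_le_exp_add_exp hκ _ _

theorem measurable_truncation (hYm : Measurable Y) (L : ℝ) : Measurable (truncation Y L) :=
  (measurable_id.indicator measurableSet_Ioc).comp hYm

theorem HasExpMoment.integrable_truncation_mul (hκ : 0 < κ) (hY : HasExpMoment κ Y P)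
    (hW : HasExpMoment κ W P) (hYm : Measurable Y) (hWm : Measurable W) (L : ℝ) :
    Integrable (fun ω => truncation Y L ω * W ω) P :=
  hY.integrable_of_abs_le hW ((measurable_truncation hYm L).mul hWm) fun ω => by
    rw [abs_mul]
    exact (mul_le_mul_of_nonneg_right (abs_truncation_le_abs_self _ _ _) (abs_nonneg _)).trans
      (abs_mul_le_exp_add_exp hκ _ _)

theorem HasExpMoment.abs_integral_mul_sub_truncation_le (hκ : 0 < κ) (hY : HasExpMoment κ Y P)
    (hW : HasExpMoment κ W P) (hYm : Measurable Y) (hWm : Measurable W) (L : ℝ) :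
    |∫ ω, Y ω * W ω ∂P - ∫ ω, truncation Y L ω * W ω ∂P| ≤
      96 * κ ^ 2 * Real.exp (-(L / (4 * κ))) := by
  rw [← integral_sub (hY.integrable_mul hκ hW hYm hWm)
    (hY.integrable_truncation_mul hκ hW hYm hWm L)]
  refine (hY.abs_integral_le hW (c := 8 * κ ^ 2 * Real.exp (-(L / (4 * κ)))) (by positivity)
    fun ω => ?_).trans (by linarith)
  set y := Y ω
  set w := W ω
  by_cases h : |y| < L
  · rw [truncation_eq_self h, sub_self, abs_zero]; positivity
  have h1 : |y * w - truncation Y L ω * w| ≤ |y| * |w| := by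
    rw [← sub_mul, abs_mul]
    refine mul_le_mul_of_nonneg_right ?_ (abs_nonneg _)
    simp only [truncation, Set.indicator, Function.comp_apply, id]
    split_ifs
    · simp [y]
    · simp [y]
  have b : ∀ u : ℝ, |u| ≤ 4 * κ * Real.exp (|u| / (4 * κ)) := fun u => by
    have := Real.add_one_le_exp (|u| / (4 * κ))
    have h2 : |u| = 4 * κ * (|u| / (4 * κ)) := by field_simp
    nlinarith
  have b2 : ∀ u : ℝ, |u| ≤ 2 * κ * Real.exp (|u| / (2 * κ)) := fun u => by
    have := Real.add_one_le_exp (|u| / (2 * κ))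
    have h2 : |u| = 2 * κ * (|u| / (2 * κ)) := by field_simp
    nlinarith
  have hy : |y| ≤ 4 * κ * (Real.exp (-(L / (4 * κ))) * Real.exp (|y| / (2 * κ))) := by
    refine (b y).trans (mul_le_mul_of_nonneg_left ?_ (by positivity))
    rw [← Real.exp_add, Real.exp_le_exp]
    have : L / (4 * κ) ≤ |y| / (4 * κ) := by
      rw [div_le_div_iff_of_pos_right (by positivity)]; exact not_lt.1 h
    have e : |y| / (2 * κ) = |y| / (4 * κ) + |y| / (4 * κ) := by field_simp; ring
    linarith
  have h2 := mul_le_mul hy (b2 w) (abs_nonneg _) (by positivity)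
  have h3 := mul_le_mul_of_nonneg_left (exp_half_mul_exp_half_le κ |y| |w|)
    (show 0 ≤ 4 * κ ^ 2 * Real.exp (-(L / (4 * κ))) by positivity)
  have h4 : 0 ≤ κ ^ 2 * Real.exp (-(L / (4 * κ))) *
    (Real.exp (|y| / κ) + Real.exp (|w| / κ)) := by positivity
  calc _ ≤ _ := h1
    _ ≤ _ := h2
    _ = 4 * κ ^ 2 * Real.exp (-(L / (4 * κ))) *
      (2 * (Real.exp (|y| / (2 * κ)) * Real.exp (|w| / (2 * κ)))) := by ring
    _ ≤ _ := h3
    _ ≤ _ := by linarith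

theorem exp_mul_truncation_mul_le {Ω : Type*} {Y W : Ω → ℝ} {κ L t : ℝ}
    (hL : 0 ≤ L) (ht : |t| * L ≤ 1 / (4 * κ)) (ω : Ω) :
    Real.exp |t * (truncation Y L ω * W ω)| ≤ Real.exp (|W ω| / (4 * κ)) := by
  rw [Real.exp_le_exp, ← mul_assoc, abs_mul, abs_mul]
  have h := abs_truncation_le_bound Y L ω
  rw [abs_of_nonneg hL] at h
  calc |t| * |truncation Y L ω| * |W ω| ≤ |t| * L * |W ω| := by gcongr
    _ ≤ 1 / (4 * κ) * |W ω| := by gcongr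
    _ = _ := by ring

theorem HasExpMoment.integrable_exp_truncation_mul (hκ : 0 < κ) (hY : HasExpMoment κ Y P)
    (hW : HasExpMoment κ W P) (hYm : Measurable Y) (hWm : Measurable W) {L t : ℝ} (hL : 0 ≤ L)
    (ht : |t| * L ≤ 1 / (4 * κ)) :
    Integrable (fun ω => Real.exp (t * (truncation Y L ω * W ω))) P := by
  refine hY.integrable_of_abs_le hW (c := 1)
    (((measurable_truncation hYm L).mul hWm).const_mul t).exp fun ω => ?_
  rw [abs_of_pos (Real.exp_pos _), one_mul]
  calc _ ≤ Real.exp |t * (truncation Y L ω * W ω)| := Real.exp_le_exp.2 (le_abs_self _)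
    _ ≤ Real.exp (|W ω| / (4 * κ)) := exp_mul_truncation_mul_le hL ht ω
    _ ≤ Real.exp (|W ω| / κ) := by
      gcongr; linarith
    _ ≤ _ := le_add_of_nonneg_left (Real.exp_pos _).le

theorem HasExpMoment.mgf_truncation_mul_le [IsProbabilityMeasure P] (hκ : 0 < κ)
    (hY : HasExpMoment κ Y P) (hW : HasExpMoment κ W P) (hYm : Measurable Y) (hWm : Measurable W)
    {L t : ℝ} (hL : 0 ≤ L) (ht : |t| * L ≤ 1 / (4 * κ)) :
    mgf (fun ω => truncation Y L ω * W ω - ∫ ω, truncation Y L ω * W ω ∂P) P t ≤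
      Real.exp (1536 * κ ^ 4 * t ^ 2) := by
  set X := fun ω => truncation Y L ω * W ω
  set e := ∫ ω, X ω ∂P
  have hXm : Measurable X := (measurable_truncation hYm L).mul hWm
  have hX : Integrable X P := hY.integrable_truncation_mul hκ hW hYm hWm L
  have hbd : ∀ ω, |X ω ^ 2 * Real.exp (|t * X ω|)| ≤
      128 * κ ^ 4 * (Real.exp (|Y ω| / κ) + Real.exp (|W ω| / κ)) := fun ω => by
    rw [abs_of_nonneg (by positivity)]
    refine le_trans ?_ (sq_mul_sq_mul_exp_le hκ (Y ω) (W ω))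
    refine mul_le_mul ?_ (exp_mul_truncation_mul_le hL ht ω) (Real.exp_pos _).le (by positivity)
    simp only [X, mul_pow]
    exact mul_le_mul_of_nonneg_right (sq_le_sq.2 (abs_truncation_le_abs_self _ _ _))
      (sq_nonneg _)
  have hi : Integrable (fun ω => X ω ^ 2 * Real.exp |t * X ω|) P :=
    hY.integrable_of_abs_le hW (by fun_prop) hbd
  have hint := (le_abs_self _).trans (hY.abs_integral_le hW (by positivity) hbd)
  have h1 : ∫ ω, Real.exp (t * X ω) ∂P ≤ 1 + t * e + t ^ 2 * (1536 * κ ^ 4) := by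
    calc ∫ ω, Real.exp (t * X ω) ∂P
        ≤ ∫ ω, (1 + t * X ω + t ^ 2 * (X ω ^ 2 * Real.exp |t * X ω|)) ∂P := by
          refine integral_mono (hY.integrable_exp_truncation_mul hκ hW hYm hWm hL ht)
            (((integrable_const 1).add (hX.const_mul t)).add (hi.const_mul _)) fun ω => ?_
          have := Real.exp_le_one_add_self_add_sq_mul_exp_abs (t * X ω)
          simp only
          linarith
      _ = 1 + t * e + t ^ 2 * ∫ ω, X ω ^ 2 * Real.exp |t * X ω| ∂P := by
          have h1X : Integrable (fun ω => 1 + t * X ω) P :=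
            (integrable_const 1).add (hX.const_mul t)
          rw [integral_add h1X (hi.const_mul _), integral_add (integrable_const 1) (hX.const_mul t),
            integral_const_mul, integral_const_mul]
          simp [e]
      _ ≤ _ := by nlinarith [sq_nonneg t]
  have h2 : mgf (fun ω => X ω - e) P t = Real.exp (-(t * e)) * ∫ ω, Real.exp (t * X ω) ∂P := by
    rw [mgf, ← integral_const_mul]
    congr 1; ext ω; rw [← Real.exp_add]; ring_nf
  rw [h2]
  have h3 := Real.add_one_le_exp (t * e + t ^ 2 * (1536 * κ ^ 4))
  calc _ ≤ Real.exp (-(t * e)) * Real.exp (t * e + t ^ 2 * (1536 * κ ^ 4)) := by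
        gcongr; linarith
    _ = _ := by rw [← Real.exp_add]; ring_nf

end HasExpMoment

/-- Chernoff bound for the sum of independent products `Y i * W i`, with `Y i` truncated. -/
theorem measureReal_abs_sum_truncation_mul_ge_le {Ω : Type*} [MeasurableSpace Ω] {P : Measure Ω}
    [IsProbabilityMeasure P] {κ : ℝ} (hκ : 0 < κ) {m : ℕ} {Y W : Fin m → Ω → ℝ}
    (hY : ∀ i, HasExpMoment κ (Y i) P) (hW : ∀ i, HasExpMoment κ (W i) P)
    (hYm : ∀ i, Measurable (Y i)) (hWm : ∀ i, Measurable (W i))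
    (hind : iIndepFun (fun i ω => (Y i ω, W i ω)) P) {L t : ℝ} (hL : 0 ≤ L) (ht0 : 0 ≤ t)
    (ht : t * L ≤ 1 / (4 * κ)) (ε : ℝ) :
    P.real {ω | ε ≤ |∑ i, (truncation (Y i) L ω * W i ω -
      ∫ ω, truncation (Y i) L ω * W i ω ∂P)|} ≤
      2 * Real.exp (-t * ε + m * (1536 * κ ^ 4 * t ^ 2)) := by
  set X : Fin m → Ω → ℝ := fun i ω => truncation (Y i) L ω * W i ω -
    ∫ ω, truncation (Y i) L ω * W i ω ∂P with hX
  have hXm : ∀ i, Measurable (X i) := fun i =>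
    ((measurable_truncation (hYm i) L).mul (hWm i)).sub_const _
  have hXind : iIndepFun X P :=
    hind.comp (fun i (p : ℝ × ℝ) => truncation id L p.1 * p.2 -
      ∫ ω, truncation (Y i) L ω * W i ω ∂P) fun i =>
        (((measurable_truncation measurable_id L).comp measurable_fst).mul
          measurable_snd).sub_const _
  have hint : ∀ r : ℝ, |r| * L ≤ 1 / (4 * κ) → ∀ i ∈ Finset.univ,
      Integrable (fun ω => Real.exp (r * X i ω)) P := fun r hr i _ => by
    have := ((hY i).integrable_exp_truncation_mul hκ (hW i) (hYm i) (hWm i) hL hr).mul_const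
      (Real.exp (-(r * ∫ ω, truncation (Y i) L ω * W i ω ∂P)))
    refine this.congr (Filter.Eventually.of_forall fun ω => ?_)
    simp only [hX]
    rw [← Real.exp_add]; congr 1; ring
  have hmgf : ∀ r : ℝ, |r| * L ≤ 1 / (4 * κ) →
      mgf (∑ i, X i) P r ≤ Real.exp (m * (1536 * κ ^ 4 * r ^ 2)) := fun r hr => by
    rw [hXind.mgf_sum hXm]
    calc _ ≤ ∏ _i : Fin m, Real.exp (1536 * κ ^ 4 * r ^ 2) :=
          Finset.prod_le_prod (fun i _ => mgf_nonneg) fun i _ =>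
            (hY i).mgf_truncation_mul_le hκ (hW i) (hYm i) (hWm i) hL hr
      _ = _ := by simp [← Real.exp_nat_mul]
  have htp : |t| * L ≤ 1 / (4 * κ) := by rwa [abs_of_nonneg ht0]
  have htn : |-t| * L ≤ 1 / (4 * κ) := by rwa [abs_neg]
  have hp := measure_ge_le_exp_mul_mgf (X := ∑ i, X i) ε ht0
    (hXind.integrable_exp_mul_sum hXm (hint t htp))
  have hn := measure_le_le_exp_mul_mgf (X := ∑ i, X i) (-ε) (neg_nonpos.2 ht0)
    (hXind.integrable_exp_mul_sum hXm (hint (-t) htn))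
  have hsub : {ω | ε ≤ |∑ i, X i ω|} ⊆
      {ω | ε ≤ (∑ i, X i) ω} ∪ {ω | (∑ i, X i) ω ≤ -ε} := fun ω hω => by
    simp only [Set.mem_ofPred_eq, Set.mem_union, Finset.sum_apply] at hω ⊢
    exact (le_abs'.1 hω).symm
  have h1 : Real.exp (-t * ε) * mgf (∑ i, X i) P t ≤
      Real.exp (-t * ε + m * (1536 * κ ^ 4 * t ^ 2)) := by
    rw [Real.exp_add]
    exact mul_le_mul_of_nonneg_left (hmgf t htp) (Real.exp_pos _).le
  have h2 : Real.exp (- -t * -ε) * mgf (∑ i, X i) P (-t) ≤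
      Real.exp (-t * ε + m * (1536 * κ ^ 4 * t ^ 2)) := by
    rw [Real.exp_add, show - -t * -ε = -t * ε by ring]
    have := hmgf (-t) htn
    rw [neg_sq] at this
    exact mul_le_mul_of_nonneg_left this (Real.exp_pos _).le
  calc _ ≤ _ := measureReal_mono hsub
    _ ≤ _ := measureReal_union_le _ _
    _ ≤ _ := by linarith

/-- Uniform deviation bound for finitely many averages of independent products of subexponential
random variables, where one factor is shared between the averages. -/
theorem one_sub_le_measureReal_forall_abs_average_le {Ω ι : Type*} [MeasurableSpace Ω] [Fintype ι]
    {P : Measure Ω} [IsProbabilityMeasure P] {κ : ℝ} (hκ : 0 < κ) {m n : ℕ} (hn : 2 ≤ n)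
    (hι : Fintype.card ι = n ^ 2) {Y : Fin m → Ω → ℝ} {W : ι → Fin m → Ω → ℝ}
    (hY : ∀ i, HasExpMoment κ (Y i) P) (hW : ∀ q i, HasExpMoment κ (W q i) P)
    (hYm : ∀ i, Measurable (Y i)) (hWm : ∀ q i, Measurable (W q i))
    (hind : ∀ q, iIndepFun (fun i ω => (Y i ω, W q i ω)) P)
    {δ : ℝ} (hδ : 0 < δ) (hδ1 : δ < 1) (hm : 12 / δ ≤ m)
    (hm' : 64 * κ ^ 4 * (Real.log (n / δ) * Real.log m ^ 2) ≤ m) :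
    1 - δ ≤ P.real {ω | ∀ q, |(1 / (m : ℝ)) * ∑ i, (Y i ω * W q i ω -
      ∫ ω, Y i ω * W q i ω ∂P)| ≤
        (1536 * κ ^ 4 + 4 + 192 * κ ^ 2) * (Real.sqrt (Real.log (n / δ)) / Real.sqrt m)} := by
  have hm12 : (12 : ℝ) ≤ m := le_trans (by rw [le_div_iff₀ hδ]; nlinarith) hm
  have hm0 : (0 : ℝ) < m := by linarith
  have hn2 : (2 : ℝ) ≤ n := by exact_mod_cast hn
  have hn0 : (0 : ℝ) < n := by linarith
  set τ := Real.log (n / δ) with hτ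
  have hnδ : 2 ≤ n / δ := by rw [le_div_iff₀ hδ]; nlinarith
  have hτ4 : 1 / 4 ≤ τ := by
    have := Real.log_le_log (by norm_num) hnδ
    linarith [Real.log_two_gt_d9]
  have hlogm : 0 ≤ Real.log m := Real.log_nonneg (by linarith)
  set L := 2 * κ * Real.log m with hLdef
  have hL : 0 ≤ L := by positivity
  set t := Real.sqrt τ / Real.sqrt m with htdef
  have ht0 : 0 ≤ t := by positivity
  have hsm : 0 < Real.sqrt m := Real.sqrt_pos.2 hm0
  have ht2 : t ^ 2 = τ / m := by
    rw [htdef, div_pow, Real.sq_sqrt (by linarith), Real.sq_sqrt hm0.le]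
  have htL : t * L ≤ 1 / (4 * κ) := by
    refine abs_le_of_sq_le_sq' ?_ (by positivity) |>.2
    rw [mul_pow, ht2, hLdef, div_pow, one_pow, le_div_iff₀ (by positivity), div_mul_eq_mul_div,
      div_mul_eq_mul_div, div_le_one hm0]
    calc _ = 64 * κ ^ 4 * (τ * Real.log m ^ 2) := by ring
      _ ≤ _ := hm'
  set M := 1536 * κ ^ 4 with hM
  have htail : ∀ i, P.real {ω | L ≤ |Y i ω|} ≤ 6 / (m : ℝ) ^ 2 := fun i => by
    refine ((hY i).measureReal_ge_le hκ L).trans_eq ?_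
    rw [show -(L / κ) = -(((2 : ℕ) : ℝ) * Real.log m) by rw [hLdef]; push_cast; field_simp,
      Real.exp_neg, Real.exp_nat_mul, Real.exp_log hm0, div_eq_mul_inv]
  have hbias : ∀ q i, |∫ ω, Y i ω * W q i ω ∂P - ∫ ω, truncation (Y i) L ω * W q i ω ∂P| ≤
      192 * κ ^ 2 * t := fun q i => by
    refine ((hY i).abs_integral_mul_sub_truncation_le hκ (hW q i) (hYm i) (hWm q i) L).trans ?_
    have e : Real.exp (-(L / (4 * κ))) = 1 / Real.sqrt m := by
      rw [show L / (4 * κ) = Real.log m / 2 by rw [hLdef]; field_simp; ring,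
        ← Real.log_sqrt hm0.le, Real.exp_neg, Real.exp_log hsm, one_div]
    have hs : 1 / 2 ≤ Real.sqrt τ := Real.le_sqrt_of_sq_le (by linarith)
    have : 1 / Real.sqrt m ≤ 2 * t := by
      rw [htdef, ← mul_div_assoc]
      exact div_le_div_of_nonneg_right (by linarith) hsm.le
    rw [e]
    nlinarith [sq_nonneg κ, mul_le_mul_of_nonneg_left this (sq_nonneg κ)]
  have hdev : ∀ q, P.real {ω | (m * ((M + 4) * t)) ≤ |∑ i, (truncation (Y i) L ω * W q i ω -
      ∫ ω, truncation (Y i) L ω * W q i ω ∂P)|} ≤ 2 * (δ / n) ^ 4 := fun q => by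
    refine (measureReal_abs_sum_truncation_mul_ge_le hκ hY (hW q) hYm (hWm q) (hind q) hL ht0
      htL _).trans_eq ?_
    have e : -t * (m * ((M + 4) * t)) + m * (1536 * κ ^ 4 * t ^ 2) = -(((4 : ℕ) : ℝ) * τ) := by
      have : m * t ^ 2 = τ := by rw [ht2]; field_simp
      rw [← this, hM]; push_cast; ring
    rw [e, Real.exp_neg, Real.exp_nat_mul, hτ, Real.exp_log (by positivity), ← inv_pow, inv_div]
  set A : Set Ω := ⋃ i, {ω | L ≤ |Y i ω|}
  set B : Set Ω := ⋃ q, {ω | (m * ((M + 4) * t)) ≤ |∑ i, (truncation (Y i) L ω * W q i ω -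
      ∫ ω, truncation (Y i) L ω * W q i ω ∂P)|}
  have hA : P.real A ≤ δ / 2 := by
    refine (measureReal_iUnion_fintype_le _).trans ((Finset.sum_le_sum fun i _ => htail i).trans ?_)
    rw [Finset.sum_const, Finset.card_univ, Fintype.card_fin, nsmul_eq_mul, ← mul_div_assoc,
      div_le_div_iff₀ (by positivity) (by norm_num)]
    rw [div_le_iff₀ hδ] at hm
    nlinarith
  have hB : P.real B ≤ δ / 2 := by
    refine (measureReal_iUnion_fintype_le _).trans ((Finset.sum_le_sum fun q _ => hdev q).trans ?_)
    rw [Finset.sum_const, Finset.card_univ, hι, nsmul_eq_mul, div_pow]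
    push_cast
    have e : (n : ℝ) ^ 2 * (2 * (δ ^ 4 / (n : ℝ) ^ 4)) = 2 * δ ^ 4 / n ^ 2 := by field_simp
    rw [e, div_le_div_iff₀ (by positivity) (by norm_num)]
    have h3 : δ ^ 4 ≤ δ := by
      simpa using pow_le_pow_of_le_one hδ.le hδ1.le (show 1 ≤ 4 by norm_num)
    have h4 : (4 : ℝ) ≤ (n : ℝ) ^ 2 := by nlinarith
    linarith [mul_le_mul_of_nonneg_left h4 hδ.le]
  have hcover : (Set.univ : Set Ω) ⊆ {ω | ∀ q, |(1 / (m : ℝ)) * ∑ i, (Y i ω * W q i ω -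
      ∫ ω, Y i ω * W q i ω ∂P)| ≤ (M + 4 + 192 * κ ^ 2) * t} ∪ (A ∪ B) := fun ω _ => by
    by_cases hAB : ω ∈ A ∪ B
    · exact Or.inr hAB
    refine Or.inl fun q => ?_
    simp only [A, B, Set.mem_union, Set.mem_iUnion, Set.mem_ofPred_eq, not_or, not_exists,
      not_le] at hAB
    obtain ⟨hωA, hωB⟩ := hAB
    have e : ∑ i, (Y i ω * W q i ω - ∫ ω, Y i ω * W q i ω ∂P) =
        ∑ i, (truncation (Y i) L ω * W q i ω - ∫ ω, truncation (Y i) L ω * W q i ω ∂P) -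
        ∑ i, (∫ ω, Y i ω * W q i ω ∂P - ∫ ω, truncation (Y i) L ω * W q i ω ∂P) := by
      rw [← Finset.sum_sub_distrib]
      refine Finset.sum_congr rfl fun i _ => ?_
      rw [truncation_eq_self (hωA i)]; ring
    have hb : |∑ i, (∫ ω, Y i ω * W q i ω ∂P - ∫ ω, truncation (Y i) L ω * W q i ω ∂P)| ≤
        m * (192 * κ ^ 2 * t) := by
      refine (Finset.abs_sum_le_sum_abs _ _).trans
        ((Finset.sum_le_sum fun i _ => hbias q i).trans_eq ?_)
      simp
    rw [abs_mul, abs_of_pos (by positivity : (0 : ℝ) < 1 / m), one_div, inv_mul_le_iff₀ hm0, e]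
    refine (abs_sub _ _).trans ?_
    linarith [hωB q]
  have h := measureReal_mono (μ := P) hcover
  rw [probReal_univ] at h
  linarith [measureReal_union_le (μ := P) {ω | ∀ q, |(1 / (m : ℝ)) * ∑ i, (Y i ω * W q i ω -
      ∫ ω, Y i ω * W q i ω ∂P)| ≤ (M + 4 + 192 * κ ^ 2) * t} (A ∪ B),
    measureReal_union_le (μ := P) A B]

theorem lintegral_le_one_of_psiNorm_le {Ω : Type*} [MeasurableSpace Ω] {P : Measure Ω} {α K c : ℝ}
    (hα : 0 ≤ α) {X : Ω → ℝ} (h : psiNorm α X P ≤ ENNReal.ofReal K) (hKc : K < c) (hc : 0 < c) :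
    ∫⁻ ω, ENNReal.ofReal (Real.exp ((|X ω| / c) ^ α) - 1) ∂P ≤ 1 := by
  have hlt : psiNorm α X P < ENNReal.ofReal c :=
    h.trans_lt ((ENNReal.ofReal_lt_ofReal_iff hc).2 hKc)
  obtain ⟨_, ⟨b, hb, rfl, hb1⟩, hbc⟩ := sInf_lt_iff.1 hlt
  have hbc' : b < c := (ENNReal.ofReal_lt_ofReal_iff hc).1 hbc
  refine (lintegral_mono fun ω => ENNReal.ofReal_le_ofReal ?_).trans hb1
  gcongr

theorem integrable_and_integral_le_two {Ω : Type*} [MeasurableSpace Ω] {P : Measure Ω}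
    [IsProbabilityMeasure P] {g : Ω → ℝ} (hg : Measurable g) (hg1 : ∀ ω, 1 ≤ g ω)
    (h : ∫⁻ ω, ENNReal.ofReal (g ω - 1) ∂P ≤ 1) : Integrable g P ∧ ∫ ω, g ω ∂P ≤ 2 := by
  have h0 : 0 ≤ᵐ[P] fun ω => g ω - 1 := Filter.Eventually.of_forall fun ω => sub_nonneg.2 (hg1 ω)
  have hm : AEStronglyMeasurable (fun ω => g ω - 1) P := (hg.sub_const 1).aestronglyMeasurable
  have hi : Integrable (fun ω => g ω - 1) P :=
    ⟨hm, (hasFiniteIntegral_iff_ofReal h0).2 (h.trans_lt ENNReal.one_lt_top)⟩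
  have hgi : Integrable g P := by
    refine (hi.add (integrable_const 1)).congr (Filter.Eventually.of_forall fun ω => ?_)
    simp
  refine ⟨hgi, ?_⟩
  have h1 : ∫ ω, (g ω - 1) ∂P ≤ 1 := by
    rw [integral_eq_lintegral_of_nonneg_ae h0 hm]
    exact ENNReal.toReal_le_of_le_ofReal zero_le_one (by simpa using h)
  rw [integral_sub hgi (integrable_const 1)] at h1
  simp at h1
  linarith

theorem charFun_map_sum_mul {Ω ι : Type*} [MeasurableSpace Ω] [Fintype ι] {P : Measure Ω}
    [IsProbabilityMeasure P] {ν : Measure ℝ} {X : ι → Ω → ℝ} (hXm : ∀ i, Measurable (X i))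
    (hX : ∀ i, P.map (X i) = ν) (hind : iIndepFun X P) (c : ι → ℝ) (t : ℝ) :
    charFun (P.map fun ω => ∑ i, c i * X i ω) t = ∏ i, charFun ν (c i * t) := by
  have h := (hind.comp (fun i x => c i * x) fun i => measurable_const_mul (c i))
  have h2 := h.charFun_map_fun_sum_eq_prod fun i =>
    ((measurable_const_mul (c i)).comp (hXm i)).aemeasurable
  simp only [Function.comp_def] at h2
  rw [h2, Finset.prod_apply]
  refine Finset.prod_congr rfl fun i _ => ?_
  rw [← charFun_map_mul, ← hX i, Measure.map_map (measurable_const_mul (c i)) (hXm i)]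
  rfl

theorem charFun_neg_of_symmetric {ν : Measure ℝ} (h : ν.map (fun z => -z) = ν) (t : ℝ) :
    charFun ν (-t) = charFun ν t := by
  have := charFun_map_mul (μ := ν) (-1) t
  simp only [neg_mul, one_mul] at this
  rw [← this, h]

theorem scaledMean_eq_sum {k : ℕ} (z : Fin k → ℝ) :
    scaledMean z = ∑ i, 1 / Real.sqrt k * z i := by
  rw [scaledMean, sampleMean, Finset.mul_sum, Finset.mul_sum]
  refine Finset.sum_congr rfl fun i _ => ?_
  rw [← mul_assoc, mul_one_div, Real.sqrt_div_self, one_div]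

theorem measurable_scaledMean {k : ℕ} : Measurable (scaledMean : (Fin k → ℝ) → ℝ) := by
  rw [funext scaledMean_eq_sum]
  fun_prop

theorem charFun_map_scaledMean {ν : Measure ℝ} [IsProbabilityMeasure ν] (k : ℕ) (t : ℝ) :
    charFun ((Measure.pi fun _ : Fin k => ν).map scaledMean) t =
      charFun ν (1 / Real.sqrt k * t) ^ k := by
  rw [funext scaledMean_eq_sum, charFun_map_sum_mul (ν := ν) (fun i => measurable_pi_apply i)
    (fun i => (measurePreserving_eval (fun _ : Fin k => ν) i).map_eq)
    (iIndepFun_pi (X := fun _ => id) fun _ => aemeasurable_id)]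
  simp

/-- If all coefficients are `0` or `± 1 / √k`, with exactly `k` of them nonzero, then a linear
combination of independent copies of a symmetric variable has the law of the scaled mean. -/
theorem prod_charFun_eq_of_isAdmissible {ν : Measure ℝ} [IsProbabilityMeasure ν]
    (hν : ν.map (fun z => -z) = ν) {n s k : ℕ} {x : EuclideanSpace ℝ (Fin n)}
    (hx : IsAdmissible s x) (hk : (Finset.univ.filter fun j : Fin n => x j ≠ 0).card = k) (t : ℝ) :
    ∏ j, charFun ν (x j * t) = charFun ν (1 / Real.sqrt k * t) ^ k := by
  obtain ⟨I, -, hI, hI'⟩ := hx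
  have hIeq : (Finset.univ.filter fun j : Fin n => x j ≠ 0) = I := by
    ext j
    simp only [Finset.mem_filter, Finset.mem_univ, true_and]
    refine ⟨fun h => by_contra fun hj => h (hI' j hj), fun hj => ?_⟩
    have hpos : 0 < 1 / Real.sqrt I.card :=
      one_div_pos.2 (Real.sqrt_pos.2 (Nat.cast_pos.2 (Finset.card_pos.2 ⟨j, hj⟩)))
    rcases hI j hj with h | h <;> rw [h]
    · exact hpos.ne'
    · exact (neg_neg_of_pos hpos).ne
  rw [hIeq] at hk
  rw [← Finset.prod_subset (Finset.subset_univ I) fun j _ hj => by simp [hI' j hj], ← hk,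
    ← Finset.prod_const]
  refine Finset.prod_congr rfl fun j hj => ?_
  rcases hI j hj with h | h <;> rw [h]
  rw [neg_mul, charFun_neg_of_symmetric hν]

theorem prod_charFun_gaussian {ι : Type*} [Fintype ι] {c : ι → ℝ} (hc : ∑ i, c i ^ 2 = 1) (t : ℝ) :
    ∏ i, charFun (gaussianReal 0 1) (c i * t) = Complex.exp (-t ^ 2 / 2) := by
  simp only [charFun_gaussianReal, ← Complex.exp_sum]
  congr 1
  have : ((∑ i, c i ^ 2 : ℝ) : ℂ) = 1 := by rw [hc]; simp
  push_cast at this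
  simp only [Complex.ofReal_zero, mul_zero, zero_mul, zero_sub, NNReal.coe_one, Complex.ofReal_one,
    one_mul, Complex.ofReal_mul, mul_pow, Finset.sum_neg_distrib]
  rw [← Finset.sum_div, ← Finset.sum_mul, this, one_mul, neg_div]

section Sample

variable {Ω Ξ : Type*} [MeasurableSpace Ω] [MeasurableSpace Ξ] {m n : ℕ} {P : Measure Ω}
  {ν : Measure ℝ} {ρ : Measure Ξ} {a : Fin m → Ω → EuclideanSpace ℝ (Fin n)} {ξ : Fin m → Ω → Ξ}
  {x : EuclideanSpace ℝ (Fin n)} {f : Ξ → ℝ → ℝ}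

theorem IsSample.measurable_coord (h : IsSample P ν ρ a ξ) (i : Fin m) (j : Fin n) :
    Measurable fun ω => a i ω j :=
  (EuclideanSpace.proj (𝕜 := ℝ) j).continuous.measurable.comp (h.measurable_vec i)

theorem IsSample.measurable_inner (h : IsSample P ν ρ a ξ) (i : Fin m) :
    Measurable fun ω => inner ℝ (a i ω) x :=
  (h.measurable_vec i).inner_const

theorem IsSample.map_inner [IsProbabilityMeasure P] (h : IsSample P ν ρ a ξ) {K : ℝ} {s k : ℕ}
    (hν : IsSamplingLaw ν K) (hk : 1 ≤ k) (hx : ‖x‖ = 1)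
    (hadm : ν ≠ gaussianReal 0 1 →
      IsAdmissible s x ∧ (Finset.univ.filter (fun j : Fin n => x j ≠ 0)).card = k) (i : Fin m) :
    P.map (fun ω => inner ℝ (a i ω) x) = (Measure.pi fun _ : Fin k => ν).map scaledMean := by
  have := hν.prob
  have e : (fun ω => inner ℝ (a i ω) x) = fun ω => ∑ j, x j * a i ω j := by
    ext ω; simp [PiLp.inner_apply]
  have := Measure.isProbabilityMeasure_map (μ := P) (h.measurable_inner (x := x) i).aemeasurable
  have := Measure.isProbabilityMeasure_map (μ := Measure.pi fun _ : Fin k => ν)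
    (measurable_scaledMean (k := k)).aemeasurable
  refine Measure.ext_of_charFun (funext fun t => ?_)
  rw [e, charFun_map_sum_mul (fun j => h.measurable_coord i j) (h.coord_law i) (h.coord_indep i),
    charFun_map_scaledMean]
  by_cases hg : ν = gaussianReal 0 1
  · subst hg
    have h1 : ∑ j, x j ^ 2 = 1 := by
      rw [← EuclideanSpace.real_norm_sq_eq, hx, one_pow]
    have h2 : ∑ _i : Fin k, (1 / Real.sqrt k) ^ 2 = 1 := by
      have : (k : ℝ) ≠ 0 := by positivity
      simp [this]
    rw [prod_charFun_gaussian h1, ← prod_charFun_gaussian h2]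
    simp
  · exact prod_charFun_eq_of_isAdmissible hν.symmetric (hadm hg).1 (hadm hg).2 t

theorem IsSample.map_noise_inner [IsProbabilityMeasure P] [IsProbabilityMeasure ρ]
    (h : IsSample P ν ρ a ξ) {K : ℝ} {s k : ℕ}
    (hν : IsSamplingLaw ν K) (hk : 1 ≤ k) (hx : ‖x‖ = 1)
    (hadm : ν ≠ gaussianReal 0 1 →
      IsAdmissible s x ∧ (Finset.univ.filter (fun j : Fin n => x j ≠ 0)).card = k) (i : Fin m) :
    P.map (fun ω => (inner ℝ (a i ω) x, ξ i ω)) =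
      (copiesLaw ν ρ k).map (Prod.map scaledMean id) := by
  have := hν.prob
  have hind : IndepFun (fun ω => inner ℝ (a i ω) x) (ξ i) P :=
    (h.noise_indep i).comp (φ := fun v => inner ℝ v x) (ψ := id)
      (measurable_id.inner_const) measurable_id
  rw [hind.map_prod_eq_prod_map_map (h.measurable_inner i).aemeasurable
    (h.measurable_noise i).aemeasurable, h.map_inner hν hk hx hadm, h.noise_law, copiesLaw,
    ← Measure.map_prod_map _ _ measurable_scaledMean measurable_id, Measure.map_id]

theorem IsSample.measurable_measurement (h : IsSample P ν ρ a ξ)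
    (hf : Measurable fun p : Ξ × ℝ => f p.1 p.2) (i : Fin m) :
    Measurable (measurement f a ξ x i) :=
  hf.comp ((h.measurable_noise i).prodMk (h.measurable_inner i))

theorem IsSample.hasExpMoment_measurement [IsProbabilityMeasure P] [IsProbabilityMeasure ρ]
    (h : IsSample P ν ρ a ξ) {K K₂ κ : ℝ} {s k : ℕ} (hν : IsSamplingLaw ν K) (hk : 1 ≤ k)
    (hx : ‖x‖ = 1) (hadm : ν ≠ gaussianReal 0 1 →
      IsAdmissible s x ∧ (Finset.univ.filter (fun j : Fin n => x j ≠ 0)).card = k)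
    (hf : Measurable fun p : Ξ × ℝ => f p.1 p.2) (hcor : CorrelationCondition f ν ρ k K₂)
    (hκ : 0 < κ) (hκ2 : K₂ < κ) (i : Fin m) :
    HasExpMoment κ (measurement f a ξ x i) P := by
  have h1 := lintegral_le_one_of_psiNorm_le zero_le_one hcor.subexponential hκ2 hκ
  have hg : Measurable fun q : ℝ × Ξ =>
      ENNReal.ofReal (Real.exp (|f q.2 q.1| / κ) - 1) := by
    have : Measurable fun q : ℝ × Ξ => f q.2 q.1 := hf.comp measurable_swap
    fun_prop
  have h2 : ∫⁻ ω, ENNReal.ofReal (Real.exp (|measurement f a ξ x i ω| / κ) - 1) ∂P ≤ 1 := by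
    have e := lintegral_map (μ := P) hg ((h.measurable_inner (x := x) i).prodMk
      (h.measurable_noise i))
    rw [h.map_noise_inner hν hk hx hadm,
      lintegral_map hg (measurable_scaledMean.prodMap measurable_id)] at e
    simp only [Real.rpow_one] at h1
    exact e.symm.trans_le h1
  have hm := h.measurable_measurement (x := x) hf i
  obtain ⟨h3, h4⟩ := integrable_and_integral_le_two
    (g := fun ω => Real.exp (|measurement f a ξ x i ω| / κ)) (by fun_prop)
    (fun ω => Real.one_le_exp (by positivity)) h2
  exact ⟨h3, by linarith⟩

theorem IsSample.exp_sq_coord [IsProbabilityMeasure P] (h : IsSample P ν ρ a ξ) {K c : ℝ}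
    (hν : IsSamplingLaw ν K) (hc : 0 < c) (hKc : K < c) (i : Fin m) (j : Fin n) :
    Integrable (fun ω => Real.exp (a i ω j ^ 2 / c ^ 2)) P ∧
      ∫ ω, Real.exp (a i ω j ^ 2 / c ^ 2) ∂P ≤ 2 := by
  have h1 := lintegral_le_one_of_psiNorm_le zero_le_two hν.subgaussian hKc hc
  have hm := h.measurable_coord i j
  refine integrable_and_integral_le_two ((hm.pow_const 2).div_const (c ^ 2)).exp
    (fun ω => Real.one_le_exp (by positivity)) ?_
  have hg : Measurable fun z : ℝ => ENNReal.ofReal (Real.exp ((|z| / c) ^ (2 : ℝ)) - 1) := by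
    fun_prop
  have e := lintegral_map (μ := P) hg hm
  rw [h.coord_law i j] at e
  rw [e] at h1
  simpa only [Real.rpow_two, div_pow, sq_abs] using h1

theorem IsSample.hasExpMoment_mul_sub [IsProbabilityMeasure P] (h : IsSample P ν ρ a ξ) {K c : ℝ}
    (hν : IsSamplingLaw ν K) (hc : 1 ≤ c) (hKc : K < c) (i : Fin m) (j l : Fin n) {d : ℝ}
    (hd : |d| ≤ 1) : HasExpMoment (c ^ 2) (fun ω => a i ω j * a i ω l - d) P := by
  have hc0 : 0 < c := by linarith
  obtain ⟨hj, hj'⟩ := h.exp_sq_coord hν hc0 hKc i j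
  obtain ⟨hl, hl'⟩ := h.exp_sq_coord hν hc0 hKc i l
  have hmj := h.measurable_coord i j
  have hml := h.measurable_coord i l
  have hm : Measurable fun ω => Real.exp (|a i ω j * a i ω l - d| / c ^ 2) :=
    ((measurable_norm.comp ((hmj.mul hml).sub_const d)).div_const (c ^ 2)).exp
  have hle : ∀ ω, Real.exp (|a i ω j * a i ω l - d| / c ^ 2) ≤
      3 / 2 * (Real.exp (a i ω j ^ 2 / c ^ 2) + Real.exp (a i ω l ^ 2 / c ^ 2)) := fun ω => by
    set u := a i ω j
    set v := a i ω l
    have h1 : |u * v - d| ≤ (u ^ 2 + v ^ 2) / 2 + 1 := by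
      refine (abs_sub _ _).trans (add_le_add ?_ hd)
      rw [abs_mul, ← sq_abs u, ← sq_abs v]
      linarith [two_mul_le_add_sq |u| |v|]
    have h2 : |u * v - d| / c ^ 2 ≤ u ^ 2 / (2 * c ^ 2) + v ^ 2 / (2 * c ^ 2) + 1 := by
      rw [div_le_iff₀ (by positivity)]
      have : (u ^ 2 / (2 * c ^ 2) + v ^ 2 / (2 * c ^ 2) + 1) * c ^ 2 =
        (u ^ 2 + v ^ 2) / 2 + c ^ 2 := by field_simp
      rw [this]
      nlinarith
    have h3 := exp_half_mul_exp_half_le (c ^ 2) (u ^ 2) (v ^ 2)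
    calc _ ≤ Real.exp (u ^ 2 / (2 * c ^ 2) + v ^ 2 / (2 * c ^ 2) + 1) := Real.exp_le_exp.2 h2
      _ = Real.exp (u ^ 2 / (2 * c ^ 2)) * Real.exp (v ^ 2 / (2 * c ^ 2)) * Real.exp 1 := by
        rw [Real.exp_add, Real.exp_add]
      _ ≤ Real.exp (u ^ 2 / (2 * c ^ 2)) * Real.exp (v ^ 2 / (2 * c ^ 2)) * 3 := by
        gcongr; linarith [Real.exp_one_lt_d9]
      _ ≤ _ := by linarith
  have hi : Integrable (fun ω => Real.exp (|a i ω j * a i ω l - d| / c ^ 2)) P := by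
    refine ((hj.add hl).const_mul (3 / 2)).mono' hm.aestronglyMeasurable
      (Filter.Eventually.of_forall fun ω => ?_)
    rw [Real.norm_of_nonneg (Real.exp_pos _).le]
    exact hle ω
  refine ⟨hi, (integral_mono hi ((hj.add hl).const_mul (3 / 2)) hle).trans ?_⟩
  simp only [Pi.add_apply]
  rw [integral_const_mul, integral_add hj hl]
  linarith

theorem IsSample.iIndepFun_measurement_mul_sub (h : IsSample P ν ρ a ξ)
    (hf : Measurable fun p : Ξ × ℝ => f p.1 p.2) (j l : Fin n) (d : ℝ) :
    iIndepFun (fun i ω => (measurement f a ξ x i ω, a i ω j * a i ω l - d)) P := by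
  have hc : ∀ j : Fin n, Measurable fun p : EuclideanSpace ℝ (Fin n) × Ξ => p.1 j := fun j =>
    (EuclideanSpace.proj (𝕜 := ℝ) j).continuous.measurable.comp measurable_fst
  refine h.sample_indep.comp
    (fun _ p => (f p.2 (inner ℝ p.1 x), p.1 j * p.1 l - d)) fun _ => ?_
  exact (hf.comp (measurable_snd.prodMk (measurable_fst.inner_const))).prodMk
    (((hc j).mul (hc l)).sub_const d)

end Sample

theorem sampleCov_apply {Ω Ξ : Type*} {m n : ℕ} (f : Ξ → ℝ → ℝ)
    (a : Fin m → Ω → EuclideanSpace ℝ (Fin n)) (ξ : Fin m → Ω → Ξ)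
    (x : EuclideanSpace ℝ (Fin n)) (ω : Ω) (j l : Fin n) :
    sampleCov f a ξ x ω j l = (1 / (m : ℝ)) * ∑ i, measurement f a ξ x i ω *
      (a i ω j * a i ω l - (1 : Matrix (Fin n) (Fin n) ℝ) j l) := by
  simp [sampleCov, Matrix.sum_apply, Matrix.vecMulVec_apply]

theorem mainTheorem5 (K₁ K₂ : ℝ) :
    ∃ C : ℝ, 0 < C ∧
      ∀ (m n s k : ℕ), 2 ≤ n → 1 ≤ k → k ≤ s →
      ∀ (Ω Ξ : Type*) [MeasurableSpace Ω] [MeasurableSpace Ξ]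
        (P : Measure Ω) [IsProbabilityMeasure P] (ν : Measure ℝ)
        (ρ : Measure Ξ) [IsProbabilityMeasure ρ]
        (f : Ξ → ℝ → ℝ) (a : Fin m → Ω → EuclideanSpace ℝ (Fin n)) (ξ : Fin m → Ω → Ξ)
        (x : EuclideanSpace ℝ (Fin n)),
      IsSamplingLaw ν K₁ →
      Measurable (fun p : Ξ × ℝ => f p.1 p.2) →
      CorrelationCondition f ν ρ k K₂ →
      IsSample P ν ρ a ξ →
      ‖x‖ = 1 →
      (ν ≠ gaussianReal 0 1 →
        IsAdmissible s x ∧ (Finset.univ.filter (fun j : Fin n => x j ≠ 0)).card = k) →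
      (∀ j l : Fin n, Integrable (fun ω => sampleCov f a ξ x ω j l) P) ∧
      ∀ δ : ℝ, 0 < δ →
        C * max ((s : ℝ) / δ) (Real.log (n / δ) * Real.log m ^ 2) ≤ m →
        1 - δ ≤ P.real {ω |
          entrySupNorm (sampleCov f a ξ x ω - matrixExpectation (sampleCov f a ξ x) P) ≤
            C * (Real.sqrt (Real.log (n / δ)) + Real.log (s / δ) ^ 2) / Real.sqrt m} := by

  set c := |K₁| + |K₂| + 1 with hcdef
  have hc1 : 1 ≤ c := by linarith [abs_nonneg K₁, abs_nonneg K₂]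
  have hc0 : 0 < c := by linarith
  have hK₁c : K₁ < c := by linarith [le_abs_self K₁, abs_nonneg K₂]
  have hK₂c : K₂ < c ^ 2 := by nlinarith [le_abs_self K₂, abs_nonneg K₁]
  have hκ : 0 < c ^ 2 := by positivity
  refine ⟨1536 * (c ^ 2) ^ 4 + 12 + 192 * (c ^ 2) ^ 2, by positivity, ?_⟩
  intro m n s k hn hk hks Ω Ξ _ _ P _ ν ρ _ f a ξ x hν hf hcor hs hx hadm
  set D : Matrix (Fin n) (Fin n) ℝ := 1
  have hD : ∀ j l, |D j l| ≤ 1 := fun j l => by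
    simp only [D, Matrix.one_apply]; split_ifs <;> simp
  have hY := hs.hasExpMoment_measurement hν hk hx hadm hf hcor hκ hK₂c
  have hYm := hs.measurable_measurement (x := x) hf
  have hW := fun (q : Fin n × Fin n) i =>
    hs.hasExpMoment_mul_sub hν hc1 hK₁c i q.1 q.2 (hD q.1 q.2)
  have hWm : ∀ (q : Fin n × Fin n) i, Measurable fun ω => a i ω q.1 * a i ω q.2 - D q.1 q.2 :=
    fun q i => ((hs.measurable_coord i q.1).mul (hs.measurable_coord i q.2)).sub_const _
  have hint := fun q i => (hY i).integrable_mul hκ (hW q i) (hYm i) (hWm q i)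
  refine ⟨fun j l => ?_, fun δ hδ hm => ?_⟩
  · simp only [sampleCov_apply]
    exact (integrable_finsetSum _ fun i _ => hint (j, l) i).const_mul _
  rcases le_or_gt 1 δ with hδ1 | hδ1
  · exact (sub_nonpos.2 hδ1).trans measureReal_nonneg
  have hs1 : (1 : ℝ) ≤ s := by exact_mod_cast hk.trans hks
  have hlog : 0 ≤ Real.log (n / δ) * Real.log m ^ 2 := by
    refine mul_nonneg (Real.log_nonneg ?_) (sq_nonneg _)
    have : (2 : ℝ) ≤ n := by exact_mod_cast hn
    rw [le_div_iff₀ hδ]; linarith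
  have hm1 : 12 / δ ≤ m := by
    refine le_trans ?_ hm
    rw [div_eq_mul_one_div]
    refine mul_le_mul ?_ (le_max_of_le_left (by gcongr)) (by positivity) (by positivity)
    nlinarith [pow_pos hκ 4, pow_pos hκ 2]
  have hm2 : 64 * (c ^ 2) ^ 4 * (Real.log (n / δ) * Real.log m ^ 2) ≤ m := by
    refine le_trans ?_ hm
    refine mul_le_mul ?_ (le_max_right _ _) hlog (by positivity)
    nlinarith [pow_pos hκ 4, pow_pos hκ 2]
  refine (one_sub_le_measureReal_forall_abs_average_le hκ hn
    (ι := Fin n × Fin n) (by simp [sq]) hY hW hYm hWm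
    (fun q => hs.iIndepFun_measurement_mul_sub hf q.1 q.2 _) hδ hδ1 hm1 hm2).trans
    (measureReal_mono fun ω hω => ?_)
  have : Nonempty (Fin n × Fin n) := ⟨⟨⟨0, by omega⟩, ⟨0, by omega⟩⟩⟩
  rw [Set.mem_ofPred_eq, entrySupNorm]
  refine ciSup_le fun q => ?_
  have e : (sampleCov f a ξ x ω - matrixExpectation (sampleCov f a ξ x) P) q.1 q.2 =
      (1 / (m : ℝ)) * ∑ i, (measurement f a ξ x i ω * (a i ω q.1 * a i ω q.2 - D q.1 q.2) -
        ∫ ω, measurement f a ξ x i ω * (a i ω q.1 * a i ω q.2 - D q.1 q.2) ∂P) := by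
    simp only [Matrix.sub_apply, matrixExpectation, Matrix.of_apply, sampleCov_apply]
    rw [integral_const_mul, integral_finsetSum _ fun i _ => hint q i, Finset.sum_sub_distrib,
      mul_sub]
  rw [e]
  refine (hω q).trans ?_
  rw [mul_div_assoc]
  have := sq_nonneg (Real.log (s / δ))
  gcongr
  · norm_num
  · exact le_add_of_nonneg_right this
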